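/- Let $\mathbb R_{\rm alg}$ be the field of real algebraic numbers, and let $\mathbf P=\mathbf P_0[1/\varepsilon]$ be the ring of Puiseux series with coefficients in $\mathbb R_{\rm alg}$, where $\mathbf P_0=\bigcup_{d\ge 1}\mathbb R_{\rm alg}[[\varepsilon^{1/d}]]$. For $\alpha\in\mathbf P$ and $q\in\mathbb Q$ let $\kappa_q(\alpha)\in\{-1,0,1\}$ be the sign of the first non-zero coefficient of $\alpha$ if its exponent is $\le q$, and $0$ if all coefficients of $\alpha$ with exponents $\le q$ vanish; put $\alpha\ge 0$ iff $\kappa_q(\alpha)\ge 0$ for all $q$. In a commutative $\mathbb Q$-algebra with a binary operation $\vee$, write $x\ge y$ for $x\vee y=x$ (and $x\le y$ for $y\ge x$), $x^+=x\vee 0$, $|x|=x\vee -x$, $x\wedge y=-(-x\vee -y)$. A *real closed ring* is a commutative $\mathbb Q$-algebra $\mathbf A$ with operations $\vee$, $\mathrm{Fr}:\mathbf A^2\to\mathbf A$ and $\rho_{d,j}:\mathbf A^d\to\mathbf A$ ($1\le j\le d$) such that 1. $\vee$ is idempotent, commutative and associative, $x+(y\vee z)=(x+y)\vee(x+z)$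 and $x^+(y\vee z)=(x^+y)\vee(x^+z)$; 2. (virtual roots) for a monic polynomial $f=X^d-(a_{d-1}X^{d-1}+\dots+a_0)$ write $\rho_{d,j}(f)=\rho_{d,j}(a_{d-1},\dots,a_0)$. Then $\rho_{1,1}(X-a)=a$, and for $d\ge 2$, $1\le j\le d$, with $f^{[1]}=f'/d$, $\sigma=(-1)^{d-j}$, $x=\rho_{d,j}(f)$, $l=\rho_{d-1,j-1}(f^{[1]})$, $r=\rho_{d-1,j}(f^{[1]})$: - if $1<j<d$: $l\le x\le r$, $\sigma(x-l)f(x)\le 0$, $\sigma(x-l)f(l)\le 0$, $\sigma(r-x)f(x)\ge 0$, $\sigma(r-x)f(r)\ge 0$; - if $j=d$: $l\le x$, $(x-l)f(x)\le 0$, $(x-l)f(l)\le 0$, $f(x)\ge 0$; - if $j=1$: $x\le r$, $\sigma(r-x)f(x)\ge 0$, $\sigma(r-x)f(r)\ge 0$, $\sigma f(x)\le 0$; and moreover $\rho_{2,2}(a+b,-ab)=a\vee b$; 3. $\mathrm{Fr}(a,b)\,|b|=(|a|\wedge|b|)^2$ and $0\le\mathrm{Fr}(a,b)\le|a|\wedge|b|$.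 It is a (not necessarily discrete) *real closed field*, i.e. a model of the theory $\mathcal Crc2$, if moreover, whenever $z(x+y)=1$ and $x+y\ge 0$, either $x$ is invertible and $x\ge 0$, or $y$ is invertible and $y\ge 0$. **Theorem.** There are operations $\vee$, $\mathrm{Fr}$, $\rho_{d,j}$ on $\mathbf P$, whose order relation $\ge$ is the one defined above by the signs $\kappa_q$, which make $\mathbf P$ a model of $\mathcal Crc2$. Moreover $\mathbf P$ is - a Heyting field: it is a local ring in which every non-invertible element is $0$; - non-Archimedean: it is false that for every $x\in\mathbf P$ there is $n\in\mathbb N$ with $|x|\le n$; - non-discrete, in the following sense: there is no algorithm which, given any program computing a sequence $u:\mathbb N\to\{0,1\}$, decides whether the Puiseux series $\sum_n u_n\varepsilon^n$ is $0$ in $\mathbf P$. -/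

import Mathlib

open Polynomial

noncomputable section

/-- Operations of the language of real closed rings on a ring `A`, besides the ring operations:
a binary `sup`, the virtual roots `rho d j` (used for `1 ≤ j ≤ d` only), of arity `d`, and the
"fraction" `fr`. The argument `a : Fin d → A` of `rho d j` stands for the monic polynomial
`X ^ d - ∑ i, a i * X ^ i`. -/
structure RealClosedOps (A : Type*) where
  sup : A → A → A
  rho : (d : ℕ) → ℕ → (Fin d → A) → A
  fr : A → A → A

/-- The monic polynomial `X ^ d - (a_{d-1} X ^ (d-1) + ⋯ + a_1 X + a_0)`. -/
def monicPoly {A : Type*} [CommRing A] {d : ℕ} (a : Fin d → A) : A[X] :=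
  X ^ d - ∑ i : Fin d, C (a i) * X ^ (i : ℕ)

/-- The coefficients (with the same sign convention) of the derivative of
`X ^ (d+1) - ∑ i, a i * X ^ i` divided by its leading coefficient `d+1`. -/
def monicDeriv {A : Type*} [CommRing A] [Algebra ℚ A] {d : ℕ} (a : Fin (d + 1) → A) :
    Fin d → A :=
  fun i => (((i : ℕ) + 1 : ℚ) / ((d : ℚ) + 1)) • a i.succ

theorem derivative_monicPoly {A : Type*} [CommRing A] [Algebra ℚ A] {d : ℕ}
    (a : Fin (d + 1) → A) :
    derivative (monicPoly a) = (d + 1 : A[X]) * monicPoly (monicDeriv a) := by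
  have h : ∀ i : Fin d, (C ((monicDeriv a) i) * (d + 1 : A[X])) = C (a i.succ) * ((i : ℕ) + 1) := by
    intro i
    have e1 : (d + 1 : A[X]) = C ((d : A) + 1) := by simp
    have e2 : (((i : ℕ) : A[X]) + 1) = C (((i : ℕ) : A) + 1) := by simp
    rw [e1, e2, ← C_mul, ← C_mul]
    congr 1
    have hd : ((d : ℚ) + 1) ≠ 0 := by positivity
    have h1 : ((d : A) + 1) = algebraMap ℚ A ((d : ℚ) + 1) := by simp
    have h2 : (((i : ℕ) : A) + 1) = algebraMap ℚ A (((i : ℕ) : ℚ) + 1) := by simp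
    rw [monicDeriv, h1, h2, Algebra.smul_def, mul_right_comm, ← map_mul, div_mul_cancel₀ _ hd,
      mul_comm]
  have e : derivative (monicPoly a) = (d + 1 : A[X]) * X ^ d -
      ∑ i : Fin d, C (a i.succ) * ((((i : ℕ) : A[X]) + 1) * X ^ (i : ℕ)) := by
    rw [monicPoly, derivative_sub, derivative_sum, Fin.sum_univ_succ]
    simp
  rw [e, monicPoly, mul_sub, Finset.mul_sum]
  congr 1
  refine Finset.sum_congr rfl fun i _ => ?_
  rw [← mul_assoc, ← h i]
  ring

namespace RealClosedOps

variable {A : Type*} [CommRing A] (S : RealClosedOps A)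

/-- `x ≤ y` abbreviates `y ∨ x = y`. -/
def Le (x y : A) : Prop := S.sup y x = y

def inf (x y : A) : A := -S.sup (-x) (-y)

def abs (x : A) : A := S.sup x (-x)

def pos (x : A) : A := S.sup x 0

/-- The axioms of strongly lattice-ordered rings (commutative `f`-rings): compatible
sup-semilattice law, and multiplication by a positive part distributes over `∨`. -/
structure IsFRing : Prop where
  sup_self : ∀ x, S.sup x x = x
  sup_comm : ∀ x y, S.sup x y = S.sup y x
  sup_assoc : ∀ x y z, S.sup (S.sup x y) z = S.sup x (S.sup y z)
  add_sup : ∀ x y z, x + S.sup y z = S.sup (x + y) (x + z)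
  pos_mul_sup : ∀ x y z, S.pos x * S.sup y z = S.sup (S.pos x * y) (S.pos x * z)

/-- The weak inequalities characterizing the point `x` of `[l, r]` where `|f|` is minimal, when `f`
is strictly monotone on `[l, r]` (increasing if `s = 1`, decreasing if `s = -1`). -/
structure IsRootBetween (s : A) (f : A[X]) (l r x : A) : Prop where
  left_le : S.Le l x
  le_right : S.Le x r
  left_self : S.Le (s * (x - l) * f.eval x) 0
  left_end : S.Le (s * (x - l) * f.eval l) 0
  right_self : S.Le 0 (s * (r - x) * f.eval x)
  right_end : S.Le 0 (s * (r - x) * f.eval r)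

/-- The same on `[l, +∞[`, with `s * f` positive near `+∞`. -/
structure IsRootAbove (s : A) (f : A[X]) (l x : A) : Prop where
  left_le : S.Le l x
  left_self : S.Le (s * (x - l) * f.eval x) 0
  left_end : S.Le (s * (x - l) * f.eval l) 0
  nonneg : S.Le 0 (s * f.eval x)

/-- The same on `]-∞, r]`, with `s * f` negative near `-∞`. -/
structure IsRootBelow (s : A) (f : A[X]) (r x : A) : Prop where
  le_right : S.Le x r
  right_self : S.Le 0 (s * (r - x) * f.eval x)
  right_end : S.Le 0 (s * (r - x) * f.eval r)
  nonpos : S.Le (s * f.eval x) 0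

/-- The axioms of virtual roots: `ρ_{1,1}(a) = a`, and for `f` monic of degree `d + 1 ≥ 2` the
root `ρ_{d+1,j}(f)` lies between the consecutive virtual roots `ρ_{d,j-1}` and `ρ_{d,j}` of the
normalized derivative of `f` (with `ρ_{d,0} = -∞` and `ρ_{d,d+1} = +∞`), where `f` is monotone of
direction `(-1) ^ (d+1-j)`; finally `ρ_{2,2}(X ^ 2 - (a + b) X + a b) = a ∨ b`. -/
structure HasVirtualRoots [Algebra ℚ A] : Prop where
  rho_one : ∀ a : Fin 1 → A, S.rho 1 1 a = a 0
  rho_first : ∀ (d : ℕ) (a : Fin (d + 1) → A), 1 ≤ d →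
    S.IsRootBelow ((-1) ^ d) (monicPoly a) (S.rho d 1 (monicDeriv a)) (S.rho (d + 1) 1 a)
  rho_middle : ∀ (d j : ℕ) (a : Fin (d + 1) → A), 2 ≤ j → j ≤ d →
    S.IsRootBetween ((-1) ^ (d + 1 - j)) (monicPoly a)
      (S.rho d (j - 1) (monicDeriv a)) (S.rho d j (monicDeriv a)) (S.rho (d + 1) j a)
  rho_last : ∀ (d : ℕ) (a : Fin (d + 1) → A), 1 ≤ d →
    S.IsRootAbove 1 (monicPoly a) (S.rho d d (monicDeriv a)) (S.rho (d + 1) (d + 1) a)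
  /- The list of coefficients is written from degree `0` upwards. -/
  rho_sup : ∀ a b : A, S.rho 2 2 ![-(a * b), a + b] = S.sup a b

/-- Real closed rings. -/
structure IsRealClosedRing [Algebra ℚ A] : Prop extends S.IsFRing, S.HasVirtualRoots where
  fr_mul_abs : ∀ a b, S.fr a b * S.abs b = (S.inf (S.abs a) (S.abs b)) ^ 2
  fr_nonneg : ∀ a b, S.Le 0 (S.fr a b)
  fr_le : ∀ a b, S.Le (S.fr a b) (S.inf (S.abs a) (S.abs b))

/-- Non-discrete real closed fields: real closed rings with the rule
`z (x + y) = 1, x + y ≥ 0 ⊢ (∃ u, u x = 1, x ≥ 0) or (∃ v, v y = 1, y ≥ 0)`. -/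
structure IsNondiscreteRealClosedField [Algebra ℚ A] : Prop extends S.IsRealClosedRing where
  afrl : ∀ x y z : A, z * (x + y) = 1 → S.Le 0 (x + y) →
    (∃ u, u * x = 1 ∧ S.Le 0 x) ∨ (∃ v, v * y = 1 ∧ S.Le 0 y)

def IsArchimedean : Prop := ∀ x : A, ∃ n : ℕ, S.Le (S.abs x) (n : A)

end RealClosedOps

/-- A Heyting field: a local ring in which every non-invertible element is zero. -/
def IsHeytingField (A : Type*) [CommRing A] : Prop :=
  IsLocalRing A ∧ ∀ x : A, ¬ IsUnit x → x = 0

/-- The ordered field of real algebraic numbers. -/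
abbrev RealAlg : Type := algebraicClosure ℚ ℝ

theorem algebraMap_eq_C (r : ℚ) :
    algebraMap ℚ (HahnSeries ℚ RealAlg) r = HahnSeries.C (algebraMap ℚ RealAlg r) :=
  DFunLike.congr_fun
    (Subsingleton.elim (algebraMap ℚ (HahnSeries ℚ RealAlg))
      ((HahnSeries.C : RealAlg →+* HahnSeries ℚ RealAlg).comp (algebraMap ℚ RealAlg))) r

/-- Puiseux series with real algebraic coefficients: Hahn series `∑ a_q ε ^ q` (the set of `q` with
`a_q ≠ 0` being well-ordered) whose exponents have a common denominator `d ≥ 1`. -/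
def Puiseux : Subalgebra ℚ (HahnSeries ℚ RealAlg) where
  carrier := {f | ∃ d : ℕ, 0 < d ∧ ∀ q ∈ f.support, ∃ k : ℤ, q = (k : ℚ) / d}
  mul_mem' := by
    rintro f g ⟨d, hd, hf⟩ ⟨e, he, hg⟩
    refine ⟨d * e, Nat.mul_pos hd he, fun q hq => ?_⟩
    obtain ⟨x, hx, y, hy, rfl⟩ := Set.mem_add.1 (HahnSeries.support_mul_subset hq)
    obtain ⟨k, rfl⟩ := hf x hx
    obtain ⟨l, rfl⟩ := hg y hy
    refine ⟨k * e + l * d, ?_⟩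
    push_cast
    field_simp
  add_mem' := by
    rintro f g ⟨d, hd, hf⟩ ⟨e, he, hg⟩
    refine ⟨d * e, Nat.mul_pos hd he, fun q hq => ?_⟩
    rcases HahnSeries.support_add_subset _ _ hq with h | h
    · obtain ⟨k, rfl⟩ := hf q h
      exact ⟨k * e, by push_cast; field_simp⟩
    · obtain ⟨k, rfl⟩ := hg q h
      exact ⟨k * d, by push_cast; field_simp⟩
  algebraMap_mem' := by
    intro r
    refine ⟨1, one_pos, fun q hq => ⟨0, ?_⟩⟩
    have : q = 0 := by
      by_contra h
      apply hq
      rw [algebraMap_eq_C]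
      exact HahnSeries.coeff_single_of_ne h
    simp [this]

namespace Puiseux

/-- The indeterminate `ε`. -/
def eps : Puiseux :=
  ⟨HahnSeries.single 1 1, 1, one_pos, fun q hq => ⟨1, by
    simpa using HahnSeries.support_single_subset hq⟩⟩

/-- The ring `P₀` of Puiseux series with exponents `≥ 0`. -/
def nonnegPart : Subalgebra ℚ Puiseux where
  carrier := {f | ∀ q ∈ f.1.support, 0 ≤ q}
  mul_mem' := by
    intro f g hf hg q hq
    obtain ⟨x, hx, y, hy, rfl⟩ := Set.mem_add.1 (HahnSeries.support_mul_subset hq)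
    exact add_nonneg (hf x hx) (hg y hy)
  add_mem' := by
    intro f g hf hg q hq
    rcases HahnSeries.support_add_subset _ _ hq with h | h
    · exact hf q h
    · exact hg q h
  algebraMap_mem' := by
    intro r q hq
    have : q = 0 := by
      by_contra h
      apply hq
      change (algebraMap ℚ (HahnSeries ℚ RealAlg) r).coeff q = 0
      rw [algebraMap_eq_C]
      exact HahnSeries.coeff_single_of_ne h
    simp [this]

/-- `ε` as an element of `P₀`. -/
def eps₀ : nonnegPart :=
  ⟨eps, fun q hq => by
    have : q = 1 := by simpa using HahnSeries.support_single_subset hq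
    simp [this]⟩

/-- The potential sign of `α` at the exponent `q`: the sign of the first non-zero coefficient
of `α` if its exponent is `≤ q`, and `0` if all coefficients with exponents `≤ q` vanish. -/
def kappa (α : Puiseux) (q : ℚ) : SignType :=
  if α.1.order ≤ q then SignType.sign α.1.leadingCoeff else 0

/-- The relation `α ≥ 0` on Puiseux series. -/
def Nonneg (α : Puiseux) : Prop := ∀ q : ℚ, 0 ≤ kappa α q

/-- The series `∑ u_n ε ^ n` of a binary sequence `u`. -/
def ofBinary (u : ℕ → Bool) : Puiseux :=
  ⟨HahnSeries.ofPowerSeries ℚ RealAlg (PowerSeries.mk fun n => if u n then 1 else 0),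
    1, one_pos, fun q hq => by
      by_contra h
      apply hq
      rw [HahnSeries.ofPowerSeries_apply]
      apply HahnSeries.embDomain_of_notMem_range
      rintro ⟨n, rfl⟩
      exact h ⟨n, by simp⟩⟩

/-- There is an algorithm which, given a program computing a binary sequence `u`, decides
whether the Puiseux series `∑ u_n ε ^ n` is zero. -/
def HasZeroTest : Prop :=
  ∃ D : Nat.Partrec.Code →. Bool, Partrec D ∧
    ∀ (c : Nat.Partrec.Code) (u : ℕ → Bool),
      (∀ n, c.eval n = Part.some (if u n then 1 else 0)) →
      ∃ b : Bool, D c = Part.some b ∧ (b = true ↔ ofBinary u = 0)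

/-- `P = P₀[1/ε]`. -/
theorem isLocalization : IsLocalization.Away eps₀ Puiseux := by
  have hpow : ∀ n : ℕ, ((eps ^ n : Puiseux) : HahnSeries ℚ RealAlg) =
      HahnSeries.single (n : ℚ) 1 := by
    intro n
    rw [SubmonoidClass.coe_pow]
    change (HahnSeries.single (1 : ℚ) (1 : RealAlg)) ^ n = _
    rw [HahnSeries.single_pow]
    simp
  have hunit : IsUnit eps := by
    refine IsUnit.of_mul_eq_one ⟨HahnSeries.single (-1) 1, 1, one_pos, fun q hq => ⟨-1, by
      simpa using HahnSeries.support_single_subset hq⟩⟩ ?_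
    apply Subtype.ext
    change HahnSeries.single (1 : ℚ) (1 : RealAlg) * HahnSeries.single (-1) 1 = 1
    rw [HahnSeries.single_mul_single]
    simp
  refine ⟨?_, ?_, ?_⟩
  · rintro ⟨y, n, rfl⟩
    exact hunit.pow n
  · intro f
    obtain ⟨n, hn⟩ := exists_nat_ge (-f.1.order)
    refine ⟨(⟨f * eps ^ n, ?_⟩, ⟨eps₀ ^ n, n, rfl⟩), ?_⟩
    · intro q hq
      change q ∈ (f.1 * ((eps ^ n : Puiseux) : HahnSeries ℚ RealAlg)).support at hq
      obtain ⟨x, hx, y, hy, rfl⟩ := Set.mem_add.1 (HahnSeries.support_mul_subset hq)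
      rw [hpow] at hy
      have hy' : y = n := by simpa using HahnSeries.support_single_subset hy
      have := HahnSeries.order_le_of_coeff_ne_zero hx
      show 0 ≤ x + y
      rw [hy']
      linarith
    · rfl
  · intro x y h
    exact ⟨1, by rw [Subtype.ext h]⟩

end Puiseux

end

/-! Classically `Puiseux` is a real closed field, totally ordered by the sign of the leading
coefficient; non-discreteness concerns only the absence of a zero test. The proof has three
independent components.

Any ordered field with the intermediate value property for polynomials is a model
(`orderedFieldOps_isNondiscreteRealClosedField`): `∨` is `max`, `Fr` is a quotient, and virtual
roots come by induction on the degree. Between consecutive virtual roots of the derivative the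
polynomial is monotone, so it has a zero there or `|f|` is least at an end. The induction carries
the sign of the polynomial between its own virtual roots (`alternatesAtVirtualRoots`), which gives
monotonicity one degree higher.

`Puiseux` has this property (`hasIVP_of_monic`) by Puiseux's method. After a translation and a
scaling of the roots, a monic polynomial has coefficients in `P₀`, no subleading term, and a
reduction at `ε = 0` different from `X ^ n`. If the reduction has no root, the polynomial is
everywhere positive. If it has a root, Weierstrass preparation over `RealAlg⟦t⟧`, with `t = ε ^ (1 /
d)`, splits the polynomial into factors of smaller degree, and the property passes to products.

Finally, `ε⁻¹` exceeds every integer, and a zero test would solve the halting problem. -/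

open Polynomial

noncomputable section

/-! ### Polynomials over ordered fields with the intermediate value property -/

section OrderedField

/-- On the interval `{y | (p → l ≤ y) ∧ (q → y ≤ r)}`, the inequalities satisfied by the point
where `|f|` is minimal when `s * f` is increasing. -/
structure IsMinPoint {F : Type*} [Field F] [LinearOrder F] (s : F) (f : F[X]) (p q : Prop)
    (l r x : F) : Prop where
  left : p → l ≤ x ∧ s * (x - l) * f.eval x ≤ 0 ∧ s * (x - l) * f.eval l ≤ 0
  right : q → x ≤ r ∧ 0 ≤ s * (r - x) * f.eval x ∧ 0 ≤ s * (r - x) * f.eval r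
  below : ¬ p → s * f.eval x ≤ 0
  above : ¬ q → 0 ≤ s * f.eval x

variable {F : Type*} [Field F] [LinearOrder F] [IsStrictOrderedRing F]

/-- As `|x| ≥ 1`, every lower power of `x` is at most `|x| ^ (n - 1)` in absolute value, and the
absolute values of the lower coefficients add up to less than `|x|`. This one estimate gives the
sign at both infinities. -/
theorem Polynomial.Monic.abs_eval_sub_pow_lt {f : F[X]} (hf : f.Monic) (hn : 0 < f.natDegree)
    {x : F} (hx : 1 + ∑ i ∈ Finset.range f.natDegree, |f.coeff i| ≤ |x|) :
    |f.eval x - x ^ f.natDegree| < |x| ^ f.natDegree := by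
  have h0 : 0 ≤ ∑ i ∈ Finset.range f.natDegree, |f.coeff i| :=
    Finset.sum_nonneg fun _ _ => abs_nonneg _
  have h1 : 1 ≤ |x| := by linarith
  obtain ⟨m, hm⟩ : ∃ m, f.natDegree = m + 1 := ⟨f.natDegree - 1, by omega⟩
  have e : f.eval x - x ^ f.natDegree = ∑ i ∈ Finset.range f.natDegree, f.coeff i * x ^ i := by
    have := congrArg (eval x) hf.as_sum
    simp only [eval_add, eval_pow, eval_X, eval_finsetSum, eval_mul, eval_C] at this
    rw [this, add_sub_cancel_left]
  rw [e]
  calc |∑ i ∈ Finset.range f.natDegree, f.coeff i * x ^ i|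
      ≤ ∑ i ∈ Finset.range f.natDegree, |f.coeff i| * |x| ^ m := by
        refine (Finset.abs_sum_le_sum_abs _ _).trans (Finset.sum_le_sum fun i hi => ?_)
        rw [abs_mul, abs_pow]
        have : i ≤ m := by have := Finset.mem_range.1 hi; omega
        gcongr
    _ = (∑ i ∈ Finset.range f.natDegree, |f.coeff i|) * |x| ^ m := by rw [Finset.sum_mul]
    _ < |x| * |x| ^ m := by
        have : 0 < |x| ^ m := by positivity
        gcongr
        linarith
    _ = |x| ^ f.natDegree := by rw [hm, pow_succ']

/-- A monic polynomial is positive far enough to the right. -/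
theorem Polynomial.Monic.eval_pos {f : F[X]} (hf : f.Monic) {x : F}
    (hx : 1 + ∑ i ∈ Finset.range f.natDegree, |f.coeff i| ≤ x) : 0 < f.eval x := by
  rcases Nat.eq_zero_or_pos f.natDegree with h | h
  · rw [hf.natDegree_eq_zero.1 h]; simp
  have h0 : 0 ≤ ∑ i ∈ Finset.range f.natDegree, |f.coeff i| :=
    Finset.sum_nonneg fun _ _ => abs_nonneg _
  have h1 : |x| = x := abs_of_nonneg (by linarith)
  have := (abs_lt.1 (hf.abs_eval_sub_pow_lt h (x := x) (by rwa [h1]))).1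
  rw [h1] at this
  linarith

/-- A monic polynomial has the sign of `(-1) ^ deg` far enough to the left. -/
theorem Polynomial.Monic.neg_one_pow_mul_eval_pos {f : F[X]} (hf : f.Monic) {x : F}
    (hx : x ≤ -(1 + ∑ i ∈ Finset.range f.natDegree, |f.coeff i|)) :
    0 < (-1) ^ f.natDegree * f.eval x := by
  rcases Nat.eq_zero_or_pos f.natDegree with h | h
  · rw [hf.natDegree_eq_zero.1 h]; simp
  have h0 : 0 ≤ ∑ i ∈ Finset.range f.natDegree, |f.coeff i| :=
    Finset.sum_nonneg fun _ _ => abs_nonneg _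
  have h1 : |x| = -x := abs_of_nonpos (by linarith)
  have h2 := hf.abs_eval_sub_pow_lt h (x := x) (by rw [h1]; linarith)
  rw [h1, neg_pow x] at h2
  rcases neg_one_pow_eq_or F f.natDegree with e | e <;> rw [e] at h2 ⊢
  · have := (abs_lt.1 h2).1
    linarith
  · have := (abs_lt.1 h2).2
    linarith

variable (F) in
/-- The intermediate value property for polynomials. -/
def PolynomialIVT : Prop :=
  ∀ (f : F[X]) (a b : F), a < b → f.eval a * f.eval b < 0 → ∃ c, a < c ∧ c < b ∧ f.eval c = 0

theorem PolynomialIVT.exists_root (H : PolynomialIVT F) {f : F[X]} {s a b : F} (hs : s ≠ 0)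
    (hab : a ≤ b) (ha : s * f.eval a ≤ 0) (hb : 0 ≤ s * f.eval b) :
    ∃ c, a ≤ c ∧ c ≤ b ∧ f.eval c = 0 := by
  rcases ha.eq_or_lt with ha | ha
  · exact ⟨a, le_rfl, hab, (mul_eq_zero.1 ha).resolve_left hs⟩
  rcases hb.eq_or_lt' with hb | hb
  · exact ⟨b, hab, le_rfl, (mul_eq_zero.1 hb).resolve_left hs⟩
  have hne : a ≠ b := by rintro rfl; exact absurd (ha.trans hb) (lt_irrefl _)
  have h1 : s * s * (f.eval a * f.eval b) < 0 := by
    have := mul_neg_of_neg_of_pos ha hb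
    linarith
  have h2 : 0 < s * s := mul_self_pos.2 hs
  obtain ⟨c, h3, h4, h5⟩ := H f a b (lt_of_le_of_ne hab hne) (by
    by_contra h; exact absurd h1 (not_lt.2 (mul_nonneg h2.le (not_lt.1 h))))
  exact ⟨c, h3.le, h4.le, h5⟩

/-- Rolle's theorem for polynomials. -/
theorem PolynomialIVT.rolle (H : PolynomialIVT F) {f : F[X]} {a b : F} (hab : a < b)
    (ha : f.eval a = 0) (hb : f.eval b = 0) : ∃ c, a < c ∧ c < b ∧ (derivative f).eval c = 0 := by
  rcases eq_or_ne f 0 with rfl | hf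
  · exact ⟨(a + b) / 2, by linarith, by linarith, by simp⟩
  have hne : (f.roots.toFinset.filter (a < ·)).Nonempty := ⟨b, by simp [hf, hab, hb]⟩
  -- Taking the first root after `a` ensures that, once the factors at `a` and `b'` are removed, the
  -- cofactor `h` has no zero on `[a, b']` and so keeps its sign.
  set b' := (f.roots.toFinset.filter (a < ·)).min' hne with hb'
  have hmem := Finset.min'_mem _ hne
  rw [← hb'] at hmem
  simp only [Finset.mem_filter, Multiset.mem_toFinset, mem_roots', IsRoot.def] at hmem
  obtain ⟨⟨-, hb0⟩, hab'⟩ := hmem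
  have hb'b : b' ≤ b := Finset.min'_le _ _ (by simp [hf, hab, hb])
  have hnoroot : ∀ c, a < c → c < b' → f.eval c ≠ 0 := fun c h1 h2 h3 =>
    absurd (Finset.min'_le _ c (by simp [hf, h1, h3])) (not_le.2 h2)
  obtain ⟨g, hg, hga⟩ := exists_eq_pow_rootMultiplicity_mul_and_not_dvd f hf a
  have hm : f.rootMultiplicity a ≠ 0 := (rootMultiplicity_pos hf).2 ha |>.ne'
  obtain ⟨m, hm⟩ := Nat.exists_eq_succ_of_ne_zero hm
  rw [hm] at hg
  have hg0 : g ≠ 0 := by rintro rfl; simp at hga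
  have hgb : g.eval b' = 0 := by
    rw [hg, eval_mul, eval_pow, eval_sub, eval_X, eval_C, mul_eq_zero] at hb0
    exact hb0.resolve_left (pow_ne_zero _ (sub_ne_zero.2 hab'.ne'))
  obtain ⟨h, hh, hhb⟩ := exists_eq_pow_rootMultiplicity_mul_and_not_dvd g hg0 b'
  have hk : g.rootMultiplicity b' ≠ 0 := (rootMultiplicity_pos hg0).2 hgb |>.ne'
  obtain ⟨k, hk⟩ := Nat.exists_eq_succ_of_ne_zero hk
  rw [hk] at hh
  have hha : h.eval a ≠ 0 := fun e => hga (by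
    rw [hh]; exact (dvd_iff_isRoot.2 e).mul_left _)
  have hhb' : h.eval b' ≠ 0 := fun e => hhb (dvd_iff_isRoot.2 e)
  have hf' : f = (X - C a) ^ (m + 1) * ((X - C b') ^ (k + 1) * h) := by rw [← hh, ← hg]
  have hpos : 0 < h.eval a * h.eval b' := by
    by_contra hc
    obtain ⟨c, h1, h2, h3⟩ := H h a b' hab'
      (lt_of_le_of_ne (not_lt.1 hc) (mul_ne_zero hha hhb'))
    exact hnoroot c h1 h2 (by rw [hf']; simp [h3])
  -- This is `f'` divided by `(X - a) ^ m * (X - b') ^ k`. Its values at `a` and `b'` are `(m + 1)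
  -- (a - b') h(a)` and `(k + 1) (b' - a) h(b')`, of opposite signs.
  obtain ⟨c, h1, h2, h3⟩ := H ((m + 1 : F[X]) * (X - C b') * h + (k + 1 : F[X]) * (X - C a) * h +
    (X - C a) * (X - C b') * derivative h) a b' hab' (by
      simp
      have : 0 < (m + 1 : F) * (k + 1) * (b' - a) ^ 2 * (h.eval a * h.eval b') := by
        have := sub_pos.2 hab'
        positivity
      linarith)
  refine ⟨c, h1, h2.trans_le hb'b, ?_⟩
  have : derivative f = (X - C a) ^ m * (X - C b') ^ k * ((m + 1 : F[X]) * (X - C b') * h +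
      (k + 1 : F[X]) * (X - C a) * h + (X - C a) * (X - C b') * derivative h) := by
    rw [hf']
    simp only [derivative_mul, derivative_X_sub_C_pow, map_natCast, Nat.cast_add, Nat.cast_one,
      Nat.add_sub_cancel, map_add, map_one]
    ring
  rw [this, eval_mul, h3, mul_zero]

/-- The mean value theorem for polynomials. -/
theorem PolynomialIVT.mean_value (H : PolynomialIVT F) (f : F[X]) {a b : F} (hab : a < b) :
    ∃ c, a < c ∧ c < b ∧ f.eval b - f.eval a = (derivative f).eval c * (b - a) := by
  have hne : b - a ≠ 0 := (sub_pos.2 hab).ne'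
  obtain ⟨c, h1, h2, h3⟩ := H.rolle
    (f := C (b - a) * (f - C (f.eval a)) - C (f.eval b - f.eval a) * (X - C a)) hab
    (by simp) (by simp; ring)
  refine ⟨c, h1, h2, ?_⟩
  simp at h3
  linarith

/-- By monotonicity, `l` works if `s * f` is already nonnegative there, `r` works if `s * f` is
still nonpositive there, and otherwise any zero in between works. The propositions `p` and `q` say
whether each end is finite, so that one argument covers all three kinds of interval. -/
theorem PolynomialIVT.exists_isMinPoint (H : PolynomialIVT F) {s : F} (hs : s ≠ 0) {f : F[X]}
    {p q : Prop} {l r : F} (hlr : p → q → l ≤ r)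
    (hmono : ∀ y z, (p → l ≤ y) → (q → z ≤ r) → y ≤ z → s * f.eval y ≤ s * f.eval z)
    (hp : ¬ p → ∀ c, ∃ y ≤ c, s * f.eval y ≤ 0) (hq : ¬ q → ∀ c, ∃ y ≥ c, 0 ≤ s * f.eval y) :
    ∃ x, IsMinPoint s f p q l r x := by
  by_cases h1 : p ∧ 0 ≤ s * f.eval l
  · obtain ⟨hp', h1⟩ := h1
    refine ⟨l, fun _ => by simp, fun hq' => ⟨hlr hp' hq', ?_, ?_⟩, fun h => absurd hp' h,
      fun _ => h1⟩
    · have := mul_nonneg (sub_nonneg.2 (hlr hp' hq')) h1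
      linarith
    · have := mul_nonneg (sub_nonneg.2 (hlr hp' hq'))
        (h1.trans (hmono l r (fun _ => le_rfl) (fun _ => le_rfl) (hlr hp' hq')))
      linarith
  by_cases h2 : q ∧ s * f.eval r ≤ 0
  · obtain ⟨hq', h2⟩ := h2
    refine ⟨r, fun hp' => ⟨hlr hp' hq', ?_, ?_⟩, fun _ => by simp, fun _ => h2,
      fun h => absurd hq' h⟩
    · have := mul_nonneg_of_nonpos_of_nonpos (sub_nonpos.2 (hlr hp' hq')) h2
      linarith
    · have := mul_nonneg_of_nonpos_of_nonpos (sub_nonpos.2 (hlr hp' hq'))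
        ((hmono l r (fun _ => le_rfl) (fun _ => le_rfl) (hlr hp' hq')).trans h2)
      linarith
  -- A missing end is replaced by a sufficiently remote point, supplied by `hp` or `hq`.
  obtain ⟨y, z, hyz, hy, hz, hly, hzr⟩ : ∃ y z, y ≤ z ∧ s * f.eval y ≤ 0 ∧ 0 ≤ s * f.eval z ∧
      (p → l ≤ y) ∧ (q → z ≤ r) := by
    by_cases hp' : p <;> by_cases hq' : q <;> simp only [hp', hq', true_and, not_le] at h1 h2
    · exact ⟨l, r, hlr hp' hq', h1.le, h2.le, fun _ => le_rfl, fun _ => le_rfl⟩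
    · obtain ⟨z, h3, h4⟩ := hq hq' l
      exact ⟨l, z, h3, h1.le, h4, fun _ => le_rfl, fun h => absurd h hq'⟩
    · obtain ⟨y, h3, h4⟩ := hp hp' r
      exact ⟨y, r, h3, h4, h2.le, fun h => absurd h hp', fun _ => le_rfl⟩
    · obtain ⟨y, h3, h4⟩ := hp hp' 0
      obtain ⟨z, h5, h6⟩ := hq hq' 0
      exact ⟨y, z, h3.trans h5, h4, h6, fun h => absurd h hp', fun h => absurd h hq'⟩
  obtain ⟨x, h3, h4, h5⟩ := H.exists_root hs hyz hy hz
  refine ⟨x, fun hp' => ⟨(hly hp').trans h3, by simp [h5], ?_⟩,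
    fun hq' => ⟨h4.trans (hzr hq'), by simp [h5], ?_⟩, fun _ => by simp [h5], fun _ => by simp [h5]⟩
  · have h6 := hmono l x (fun _ => le_rfl) (fun hq' => h4.trans (hzr hq')) ((hly hp').trans h3)
    rw [h5, mul_zero] at h6
    have := mul_nonneg (sub_nonneg.2 ((hly hp').trans h3)) (neg_nonneg.2 h6)
    linarith
  · have h6 := hmono x r (fun hp' => (hly hp').trans h3) (fun _ => le_rfl) (h4.trans (hzr hq'))
    rw [h5, mul_zero] at h6
    have := mul_nonneg (sub_nonneg.2 (h4.trans (hzr hq'))) h6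
    linarith

end OrderedField

section MonicPoly

variable {A : Type*} [CommRing A] {d : ℕ} (a : Fin d → A)

theorem monic_monicPoly : (monicPoly a).Monic :=
  monic_X_pow_sub (degree_sum_fin_lt a)

theorem natDegree_monicPoly [Nontrivial A] : (monicPoly a).natDegree = d := by
  refine natDegree_eq_of_degree_eq_some ?_
  rw [monicPoly, degree_sub_eq_left_of_degree_lt, degree_X_pow]
  rw [degree_X_pow]
  exact degree_sum_fin_lt a

end MonicPoly

/-! ### Virtual roots and the model structure on an ordered field -/

section VirtualRoots

/-- The virtual roots of the monic polynomials over an ordered field. -/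
def virtualRoot {F : Type*} [Field F] [LinearOrder F] [Algebra ℚ F] :
    (d : ℕ) → ℕ → (Fin d → F) → F
  -- A junk value: the axioms start in degree one.
  | 0, _, _ => 0
  | 1, _, a => a 0
  -- For `j = 1` and `j = d + 2` one of the two neighbours is meaningless, but the corresponding
  -- proposition is then false, so it plays no role.
  | d + 2, j, a => Classical.epsilon fun x =>
      IsMinPoint ((-1) ^ (d + 2 - j)) (monicPoly a) (2 ≤ j) (j ≤ d + 1)
        (virtualRoot (d + 1) (j - 1) (monicDeriv a)) (virtualRoot (d + 1) j (monicDeriv a)) x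

/-- The operations of the language of real closed rings on an ordered field. -/
def orderedFieldOps (F : Type*) [Field F] [LinearOrder F] [Algebra ℚ F] : RealClosedOps F where
  sup := max
  rho := virtualRoot
  -- For `b = 0` the convention `x / 0 = 0` gives the only value allowed by `0 ≤ Fr(a, b) ≤ |a| ∧
  -- |b|`.
  fr a b := min |a| |b| ^ 2 / |b|

theorem orderedFieldOps_le {F : Type*} [Field F] [LinearOrder F] {_ : Algebra ℚ F} {x y : F} :
    (orderedFieldOps F).Le x y ↔ x ≤ y := max_eq_left_iff

theorem orderedFieldOps_abs {F : Type*} [Field F] [LinearOrder F] {_ : Algebra ℚ F} (x : F) :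
    (orderedFieldOps F).abs x = |x| := rfl

variable {F : Type*} [Field F] [LinearOrder F] [IsStrictOrderedRing F] [Algebra ℚ F]

/-- The virtual roots of `a` increase, and `monicPoly a` has constant sign between any two
consecutive ones. -/
structure AlternatesAtVirtualRoots {d : ℕ} (a : Fin d → F) : Prop where
  le_succ : ∀ j, 1 ≤ j → j < d → virtualRoot d j a ≤ virtualRoot d (j + 1) a
  sign : ∀ j ≤ d, ∀ y, (1 ≤ j → virtualRoot d j a < y) → (j < d → y < virtualRoot d (j + 1) a) →
    0 ≤ (-1) ^ (d - j) * (monicPoly a).eval y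

/-- The sign pattern of the normalized derivative, fed into the mean value theorem, gives the
direction of variation of the polynomial itself. -/
theorem AlternatesAtVirtualRoots.monotone (H : PolynomialIVT F) {d : ℕ} {a : Fin (d + 1) → F}
    (h : AlternatesAtVirtualRoots (monicDeriv a)) {j : ℕ} (h1 : 1 ≤ j) (hd : j ≤ d + 1) {y z : F}
    (hy : 2 ≤ j → virtualRoot d (j - 1) (monicDeriv a) ≤ y)
    (hz : j ≤ d → z ≤ virtualRoot d j (monicDeriv a)) (hyz : y ≤ z) :
    (-1) ^ (d + 1 - j) * (monicPoly a).eval y ≤ (-1) ^ (d + 1 - j) * (monicPoly a).eval z := by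
  rcases hyz.eq_or_lt with rfl | hyz
  · exact le_rfl
  obtain ⟨c, hyc, hcz, e⟩ := H.mean_value (monicPoly a) hyz
  obtain ⟨j, rfl⟩ := Nat.exists_eq_add_of_le' h1
  have h2 := h.sign j (by omega) c (fun h3 => (hy (by omega)).trans_lt hyc)
    (fun h3 => hcz.trans_le (hz (by omega)))
  rw [derivative_monicPoly, eval_mul] at e
  have h3 : (0 : F) ≤ ((d + 1 : F[X]).eval c) := by
    simp; positivity
  have h4 := mul_nonneg (mul_nonneg h3 h2) (sub_nonneg.2 hyz.le)
  rw [Nat.add_sub_add_right, ← sub_nonneg, ← mul_sub, e]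
  linarith

theorem AlternatesAtVirtualRoots.isMinPoint (H : PolynomialIVT F) {d : ℕ} {a : Fin (d + 2) → F}
    (h : AlternatesAtVirtualRoots (monicDeriv a)) {j : ℕ} (h1 : 1 ≤ j) (hd : j ≤ d + 2) :
    IsMinPoint ((-1) ^ (d + 2 - j)) (monicPoly a) (2 ≤ j) (j ≤ d + 1)
      (virtualRoot (d + 1) (j - 1) (monicDeriv a)) (virtualRoot (d + 1) j (monicDeriv a))
      (virtualRoot (d + 2) j a) := by
  have hm := monic_monicPoly a
  have hn := natDegree_monicPoly a
  rw [virtualRoot]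
  refine Classical.epsilon_spec (p := fun x => IsMinPoint ((-1) ^ (d + 2 - j)) (monicPoly a)
    (2 ≤ j) (j ≤ d + 1) (virtualRoot (d + 1) (j - 1) (monicDeriv a))
    (virtualRoot (d + 1) j (monicDeriv a)) x) (H.exists_isMinPoint (pow_ne_zero _ (by simp)) ?_
      (fun y z hy hz hyz => h.monotone H h1 hd hy hz hyz) ?_ ?_)
  · intro h2 h3
    obtain ⟨j, rfl⟩ := Nat.exists_eq_add_of_le' h1
    exact h.le_succ j (by omega) (by omega)
  · intro h2 c
    obtain rfl : j = 1 := by omega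
    refine ⟨min c (-(1 + ∑ i ∈ Finset.range (monicPoly a).natDegree, |(monicPoly a).coeff i|)),
      min_le_left _ _, ?_⟩
    have h3 := hm.neg_one_pow_mul_eval_pos (min_le_right c _)
    rw [hn, pow_succ] at h3
    rw [show d + 2 - 1 = d + 1 by omega, hn]
    linarith
  · intro h2 c
    obtain rfl : j = d + 2 := by omega
    refine ⟨max c (1 + ∑ i ∈ Finset.range (monicPoly a).natDegree, |(monicPoly a).coeff i|),
      le_max_left _ _, ?_⟩
    simpa using (hm.eval_pos (le_max_right c _)).le

/-- Induction on the degree. Consecutive virtual roots are separated by a virtual root of the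
derivative. A point between them lies either to the right of the first one or to the left of the
second one within a single interval of monotonicity, and its sign follows from the sign at that
virtual root. -/
theorem alternatesAtVirtualRoots (H : PolynomialIVT F) :
    ∀ {d : ℕ} (a : Fin (d + 1) → F), AlternatesAtVirtualRoots a
  | 0, a => by
    have e : ∀ y, (monicPoly a).eval y = y - a 0 := fun y => by simp [monicPoly]
    refine ⟨fun j h1 h2 => by omega, fun j hj y h1 h2 => ?_⟩
    rw [e]
    rcases Nat.eq_zero_or_pos j with rfl | h3
    · have := h2 (by omega)
      simp only [virtualRoot] at this
      simp; linarith
    · obtain rfl : j = 1 := by omega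
      have := h1 (by omega)
      simp only [virtualRoot] at this
      simp; linarith
  | d + 1, a => by
    have ih := alternatesAtVirtualRoots H (monicDeriv a)
    refine ⟨fun j h1 h2 => ?_, fun j hj y h1 h2 => ?_⟩
    · exact ((ih.isMinPoint H h1 (by omega)).right (by omega)).1.trans
        ((ih.isMinPoint H (by omega : 1 ≤ j + 1) (by omega)).left (by omega)).1
    -- Decides on which side of the `j`-th virtual root of the derivative `y` lies. In the second
    -- case the interval has index `j + 1`, hence the opposite direction.
    by_cases hc : 1 ≤ j ∧ (j ≤ d + 1 → y ≤ virtualRoot (d + 1) j (monicDeriv a))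
    · obtain ⟨hj1, hy⟩ := hc
      have hx := ih.isMinPoint H hj1 hj
      have hxy := h1 hj1
      refine le_trans ?_ (ih.monotone H hj1 hj (fun h => (hx.left h).1) hy hxy.le)
      by_cases h3 : j ≤ d + 1
      · have h4 := (hx.right h3).2.1
        have h5 := sub_pos.2 (hxy.trans_le (hy h3))
        rw [mul_right_comm] at h4
        exact nonneg_of_mul_nonneg_left h4 h5
      · exact hx.above h3
    · have hj1 : j ≤ d + 1 := by
        by_contra h3; exact hc ⟨by omega, fun h4 => absurd h4 h3⟩
      have hx := ih.isMinPoint H (by omega : 1 ≤ j + 1) (by omega : j + 1 ≤ d + 2)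
      have hyx := h2 (by omega)
      have hy : 2 ≤ j + 1 → virtualRoot (d + 1) (j + 1 - 1) (monicDeriv a) < y := by
        intro h3
        by_contra h4
        exact hc ⟨by omega, fun _ => not_lt.1 h4⟩
      have h6 := ih.monotone H (by omega : 1 ≤ j + 1) (by omega : j + 1 ≤ d + 2)
        (fun h => (hy h).le) (fun h => (hx.right h).1) hyx.le
      have h7 : (-1) ^ (d + 1 + 1 - (j + 1)) * (monicPoly a).eval (virtualRoot (d + 2) (j + 1) a)
          ≤ 0 := by
        by_cases h3 : 2 ≤ j + 1
        · have h4 := (hx.left h3).2.1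
          have h5 := sub_pos.2 ((hy h3).trans hyx)
          rw [mul_right_comm] at h4
          exact nonpos_of_mul_nonpos_left h4 h5
        · exact hx.below h3
      have h8 := h6.trans h7
      rw [show d + 1 + 1 - j = (d + 1 + 1 - (j + 1)) + 1 by omega, pow_succ]
      linarith

theorem virtualRoot_two (H : PolynomialIVT F) (a b : F) :
    virtualRoot 2 2 ![-(a * b), a + b] = max a b := by
  have h := (alternatesAtVirtualRoots H (monicDeriv ![-(a * b), a + b])).isMinPoint H
    (j := 2) (by omega) (by omega)
  obtain ⟨h1, h2, h3⟩ := h.left le_rfl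
  have h4 := h.above (by omega)
  have el : virtualRoot (0 + 1) (2 - 1) (monicDeriv ![-(a * b), a + b]) = (a + b) / 2 := by
    simp [virtualRoot, monicDeriv, Algebra.smul_def]
    ring
  have ef : ∀ y, (monicPoly ![-(a * b), a + b]).eval y = (y - a) * (y - b) := fun y => by
    simp [monicPoly, Fin.sum_univ_two]
    ring
  rw [el] at h1 h2 h3
  rw [ef] at h2 h3 h4
  simp only [Nat.sub_self, pow_zero, one_mul, zero_add] at h1 h2 h3 h4
  set x := virtualRoot 2 2 ![-(a * b), a + b]
  -- At the midpoint the polynomial equals `-((a - b) / 2) ^ 2`, so nonnegativity forces it to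
  -- vanish; beyond the midpoint both inequalities on `f(x)` hold. A root not below the midpoint is
  -- the larger one.
  have hx : (x - a) * (x - b) = 0 := by
    rcases h1.eq_or_lt with h1 | h1
    · have : (x - a) * (x - b) = -((a - b) / 2) ^ 2 := by rw [← h1]; ring
      nlinarith [sq_nonneg ((a - b) / 2)]
    · exact le_antisymm (nonpos_of_mul_nonpos_right h2 (sub_pos.2 h1)) h4
  rcases mul_eq_zero.1 hx with hx | hx
  · rw [max_eq_left (by linarith)]; linarith
  · rw [max_eq_right (by linarith)]; linarith

theorem orderedFieldOps_inf (x y : F) : (orderedFieldOps F).inf x y = min x y := by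
  change -max (-x) (-y) = _
  rw [max_neg_neg, neg_neg]

theorem orderedFieldOps_isNondiscreteRealClosedField (H : PolynomialIVT F) :
    (orderedFieldOps F).IsNondiscreteRealClosedField where
  sup_self := max_self
  sup_comm := max_comm
  sup_assoc := max_assoc
  add_sup x y z := (max_add_add_left x y z).symm
  pos_mul_sup x y z := mul_max_of_nonneg y z (le_max_right x 0)
  rho_one a := by simp [orderedFieldOps, virtualRoot]
  rho_first d a hd := by
    obtain ⟨d, rfl⟩ := Nat.exists_eq_add_of_le' hd
    have h := (alternatesAtVirtualRoots H (monicDeriv a)).isMinPoint H (j := 1) le_rfl (by omega)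
    obtain ⟨h1, h2, h3⟩ := h.right (by omega)
    have h4 := h.below (by omega)
    constructor <;> rw [orderedFieldOps_le] <;> assumption
  rho_middle d j a hj hjd := by
    obtain ⟨d, rfl⟩ := Nat.exists_eq_add_of_le' (show 1 ≤ d by omega)
    have h := (alternatesAtVirtualRoots H (monicDeriv a)).isMinPoint H (j := j)
      (by omega) (by omega)
    obtain ⟨h1, h2, h3⟩ := h.right (by omega)
    obtain ⟨h4, h5, h6⟩ := h.left (by omega)
    constructor <;> rw [orderedFieldOps_le] <;> assumption
  rho_last d a hd := by
    obtain ⟨d, rfl⟩ := Nat.exists_eq_add_of_le' hd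
    have h := (alternatesAtVirtualRoots H (monicDeriv a)).isMinPoint H (j := d + 2)
      (by omega) (by omega)
    obtain ⟨h1, h2, h3⟩ := h.left (by omega)
    have h4 := h.above (by omega)
    rw [Nat.sub_self, pow_zero] at h2 h3 h4
    constructor <;> rw [orderedFieldOps_le] <;> assumption
  rho_sup a b := virtualRoot_two H a b
  fr_mul_abs a b := by
    rw [orderedFieldOps_abs, orderedFieldOps_abs, orderedFieldOps_inf]
    change min |a| |b| ^ 2 / |b| * |b| = _
    rcases eq_or_ne b 0 with rfl | hb
    · simp
    · exact div_mul_cancel₀ _ (abs_ne_zero.2 hb)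
  fr_nonneg a b := by
    rw [orderedFieldOps_le]
    change 0 ≤ min |a| |b| ^ 2 / |b|
    positivity
  fr_le a b := by
    rw [orderedFieldOps_le, orderedFieldOps_abs, orderedFieldOps_abs, orderedFieldOps_inf]
    change min |a| |b| ^ 2 / |b| ≤ _
    refine div_le_of_le_mul₀ (abs_nonneg _) (by positivity) ?_
    rw [sq]
    gcongr
    exact min_le_right _ _
  afrl x y z hz hxy := by
    simp only [orderedFieldOps_le] at hxy ⊢
    have hne : x + y ≠ 0 := by
      intro h; simp [h] at hz
    have hpos := lt_of_le_of_ne hxy hne.symm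
    rcases lt_or_ge 0 x with hx | hx
    · exact Or.inl ⟨x⁻¹, inv_mul_cancel₀ hx.ne', hx.le⟩
    · have hy : 0 < y := by linarith
      exact Or.inr ⟨y⁻¹, inv_mul_cancel₀ hy.ne', hy.le⟩

end VirtualRoots

/-! ### Factorization over complete local rings and power series -/

section Factorization

/-- Over a complete local ring, a monic polynomial whose reduction is divisible by `X` without
being a power of `X` has a nontrivial monic factorization. -/
theorem Polynomial.Monic.exists_factorization_of_residue {A : Type*} [CommRing A] [IsLocalRing A]
    [IsAdicComplete (IsLocalRing.maximalIdeal A) A] {f : A[X]} (hf : f.Monic)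
    (h0 : IsLocalRing.residue A (f.coeff 0) = 0)
    (h1 : ∃ i < f.natDegree, IsLocalRing.residue A (f.coeff i) ≠ 0) :
    ∃ g q : A[X], g.Monic ∧ q.Monic ∧ f = g * q ∧ 0 < g.natDegree ∧
      g.natDegree < f.natDegree := by
  have hne : PowerSeries.map (IsLocalRing.residue A) (f : PowerSeries A) ≠ 0 := by
    obtain ⟨i, -, hi⟩ := h1
    intro h
    apply hi
    simpa using congrArg (PowerSeries.coeff i) h
  obtain ⟨g, h, H⟩ := PowerSeries.exists_isWeierstrassFactorization hne
  have hg := H.isDistinguishedAt.monic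
  have hdeg := H.natDegree_eq_toNat_order_map
  have hord := ENat.natCast_toNat (PowerSeries.order_finite_iff_ne_zero.2 hne).ne
  rw [← hdeg] at hord
  -- Weierstrass preparation only gives `f = g * h` with `h` a power series. Euclidean division of
  -- `f` by `g` is also a Weierstrass division, so uniqueness makes its remainder zero.
  have hmod : f %ₘ g = 0 := by
    refine (H.isDistinguishedAt.isWeierstrassDivisorAt'.eq_of_mul_add_eq_mul_add
      (q := ((f /ₘ g : A[X]) : PowerSeries A)) (q' := h) (r' := 0) ?_ ?_ ?_).2
    · refine (degree_modByMonic_lt f hg).trans_eq ?_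
      rw [degree_eq_natDegree hg.ne_zero]
      rw [← H.isDistinguishedAt.coe_natDegree_eq_order_map (g : PowerSeries A) 1 (by simp)
        (by simp), ENat.toNat_natCast]
    · rw [degree_zero]; exact WithBot.bot_lt_coe _
    · rw [Polynomial.coe_zero, add_zero, ← H.eq_mul, ← Polynomial.coe_mul, ← Polynomial.coe_add,
        add_comm, modByMonic_add_div f g]
  have hfac : f = g * (f /ₘ g) := by
    conv_lhs => rw [← modByMonic_add_div f g, hmod, zero_add]
  refine ⟨g, f /ₘ g, hg, hg.of_mul_monic_left (by rwa [← hfac]), hfac, ?_, ?_⟩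
  -- The degree of `g` is the order of the reduction of `f`: positive by `h0`, less than the degree
  -- of `f` by `h1`.
  · rw [Nat.pos_iff_ne_zero]
    intro h2
    rw [h2] at hord
    have := (PowerSeries.order_eq_nat.1 hord.symm).1
    simp [h0] at this
  · obtain ⟨i, hi, hi'⟩ := h1
    refine lt_of_le_of_lt ?_ hi
    have : (g.natDegree : ℕ∞) ≤ i := by
      rw [hord]
      exact PowerSeries.order_le i (by simpa using hi')
    exact_mod_cast this

theorem PowerSeries.residue_eq_zero_iff {K : Type*} [Field K] {a : PowerSeries K} :
    IsLocalRing.residue (PowerSeries K) a = 0 ↔ PowerSeries.constantCoeff a = 0 := by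
  rw [IsLocalRing.residue_eq_zero_iff, PowerSeries.maximalIdeal_eq_span_X,
    Ideal.mem_span_singleton, PowerSeries.X_dvd_iff]

/-- A monic polynomial over `K⟦t⟧` whose reduction has a root `c` without being a power of `X - c`
has a nontrivial monic factorization. -/
theorem Polynomial.Monic.exists_factorization_of_isRoot {K : Type*} [Field K]
    {f : (PowerSeries K)[X]} (hf : f.Monic) {c : K}
    (hc : (f.map PowerSeries.constantCoeff).IsRoot c)
    (hne : f.map PowerSeries.constantCoeff ≠ (X - C c) ^ f.natDegree) :
    ∃ g q : (PowerSeries K)[X], g.Monic ∧ q.Monic ∧ f = g * q ∧ 0 < g.natDegree ∧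
      g.natDegree < f.natDegree := by
  have : IsAdicComplete (IsLocalRing.maximalIdeal (PowerSeries K)) (PowerSeries K) := by
    rw [PowerSeries.maximalIdeal_eq_span_X]; infer_instance
  have hmon : ∀ (p : (PowerSeries K)[X]) r, p.Monic → (taylor r p).Monic := fun p r hp => by
    rw [Monic, leadingCoeff_taylor]; exact hp
  set r : PowerSeries K := PowerSeries.C c with hr
  have hcoeff : ∀ i, PowerSeries.constantCoeff ((taylor r f).coeff i) =
      (taylor c (f.map PowerSeries.constantCoeff)).coeff i := fun i => by
    rw [← coeff_map, map_taylor, hr, PowerSeries.constantCoeff_C]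
  obtain ⟨g, q, hg, hq, e, h1, h2⟩ := (hmon f r hf).exists_factorization_of_residue
    (by rw [PowerSeries.residue_eq_zero_iff, hcoeff, taylor_coeff_zero]; exact hc) (by
      by_contra! h
      apply hne
      apply taylor_injective c
      have hm := (hmon f r hf).map PowerSeries.constantCoeff
      rw [map_taylor, hr, PowerSeries.constantCoeff_C] at hm
      have hd : (taylor c (f.map PowerSeries.constantCoeff)).natDegree = f.natDegree := by
        rw [natDegree_taylor, hf.natDegree_map]
      rw [taylor_pow, map_sub, taylor_X, taylor_C, add_sub_cancel_right]
      ext i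
      rw [coeff_X_pow]
      split_ifs with hi
      · rw [hi, ← hd]; exact hm
      · rcases lt_or_gt_of_ne hi with hi | hi
        · rw [← hcoeff, ← PowerSeries.residue_eq_zero_iff]
          exact h i (by rwa [natDegree_taylor])
        · exact coeff_eq_zero_of_natDegree_lt (hd ▸ hi))
  refine ⟨taylor (-r) g, taylor (-r) q, hmon _ _ hg, hmon _ _ hq, ?_, ?_, ?_⟩
  · rw [← taylor_mul, ← e, taylor_taylor, neg_add_cancel, taylor_zero]
  · rwa [natDegree_taylor]
  · rwa [natDegree_taylor, ← natDegree_taylor f r]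

end Factorization

/-- A zero found in `ℝ` is algebraic over `RealAlg`, hence over `ℚ`, so it already lies in
`RealAlg`. -/
theorem RealAlg.polynomialIVT : PolynomialIVT RealAlg := by
  intro f a b hab h
  let φ : RealAlg →+* ℝ := algebraMap RealAlg ℝ
  have hφ : ∀ x : RealAlg, φ (f.eval x) = (f.map φ).eval (x : ℝ) := fun x => by
    rw [← eval₂_at_apply, eval_map]; rfl
  have hfne : f ≠ 0 := by rintro rfl; simp at h
  have hsign : (f.map φ).eval (a : ℝ) * (f.map φ).eval (b : ℝ) < 0 := by
    rw [← hφ, ← hφ, ← map_mul]; exact h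
  have hcont : ContinuousOn (fun x => (f.map φ).eval x) (Set.Icc (a : ℝ) b) :=
    (f.map φ).continuous.continuousOn
  have hab' : (a : ℝ) ≤ b := hab.le
  obtain ⟨c, ⟨h1, h2⟩, h3⟩ : ∃ c ∈ Set.Ioo (a : ℝ) b, (f.map φ).eval c = 0 := by
    rcases mul_neg_iff.1 hsign with ⟨h1, h2⟩ | ⟨h1, h2⟩
    · exact intermediate_value_Ioo' hab' hcont ⟨h2, h1⟩
    · exact intermediate_value_Ioo hab' hcont ⟨h1, h2⟩
  have halg : IsAlgebraic RealAlg c := ⟨f, hfne, by rwa [aeval_def, ← eval_map]⟩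
  have : Algebra.IsAlgebraic ℚ RealAlg := ⟨fun x =>
    (isAlgebraic_algebraMap_iff φ.injective).1 (mem_algebraicClosure_iff.1 x.2)⟩
  have hc : c ∈ algebraicClosure ℚ ℝ := mem_algebraicClosure_iff.2 (halg.restrictScalars ℚ)
  refine ⟨⟨c, hc⟩, h1, h2, ?_⟩
  apply φ.injective
  rw [hφ, map_zero]
  exact h3

theorem PolynomialIVT.eval_pos {F : Type*} [Field F] [LinearOrder F] [IsStrictOrderedRing F]
    (H : PolynomialIVT F) {f : F[X]} (hf : f.Monic) (h : ∀ c, ¬ f.IsRoot c) (x : F) :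
    0 < f.eval x := by
  by_contra hx
  obtain ⟨c, -, -, hc⟩ := H f x (max (x + 1) (1 + ∑ i ∈ Finset.range f.natDegree, |f.coeff i|))
    ((lt_add_one x).trans_le (le_max_left _ _))
    (mul_neg_of_neg_of_pos (lt_of_le_of_ne (not_lt.1 hx) (h x)) (hf.eval_pos (le_max_right _ _)))
  exact h c hc

/-! ### Undecidability of the zero test -/

namespace Puiseux

open Nat.Partrec in
/-- A zero test would decide the halting problem: apply it to the sequence whose `n`-th term tells
whether a given program has stopped after `n` steps. -/
theorem not_hasZeroTest : ¬ HasZeroTest := by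
  rintro ⟨D, hD, h⟩
  have hzero : ∀ u : ℕ → Bool, ofBinary u = 0 ↔ ∀ n, u n = false := by
    intro u
    rw [Subtype.ext_iff]
    change HahnSeries.ofPowerSeries ℚ RealAlg _ = 0 ↔ _
    rw [map_eq_zero_iff _ HahnSeries.ofPowerSeries_injective, PowerSeries.ext_iff]
    simp
  let u : Code → ℕ → Bool := fun c n => (Code.evaln n c 0).isSome
  have hu : Computable₂ fun c n => if u c n then (1 : ℕ) else 0 := by
    have h1 : Primrec₂ u := Primrec.option_isSome.comp
      (Code.primrec_evaln.comp ((Primrec.snd.pair Primrec.fst).pair (Primrec.const 0)))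
    exact (Primrec.ite (Primrec.eq.comp h1 (Primrec.const true)) (Primrec.const 1)
      (Primrec.const 0)).to_comp
  -- The s-m-n theorem: currying one code for the two-variable function turns a program `c`
  -- computably into a program for the sequence `u c`.
  obtain ⟨s, hs, hs'⟩ : ∃ s : Code → Code, Computable s ∧
      ∀ c n, (s c).eval n = Part.some (if u c n then 1 else 0) := by
    let g : ℕ → ℕ := fun m => if u (Denumerable.ofNat Code m.unpair.1) m.unpair.2 then 1 else 0
    have hg : Computable g := hu.comp
      ((Computable.ofNat Code).comp (Computable.fst.comp Primrec.unpair.to_comp))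
      (Computable.snd.comp Primrec.unpair.to_comp)
    obtain ⟨c₀, hc₀⟩ := Code.exists_code.1 (Partrec.nat_iff.1 hg.partrec)
    refine ⟨fun c => c₀.curry (Encodable.encode c), (Code.primrec₂_curry.comp
      (Primrec.const c₀) Primrec.encode).to_comp, fun c n => ?_⟩
    rw [Code.eval_curry, hc₀]
    simp [g]
  have hspec : ∀ c, ∃ b : Bool, D (s c) = Part.some b ∧ (b = true ↔ ¬ (c.eval 0).Dom) := by
    intro c
    obtain ⟨b, hb, hb'⟩ := h (s c) (u c) (hs' c)
    refine ⟨b, hb, hb'.trans ((hzero _).trans ?_)⟩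
    rw [Part.dom_iff_mem]
    simp only [u, Option.isSome_eq_false_iff, Option.isNone_iff_eq_none,
      Option.eq_none_iff_forall_not_mem]
    constructor
    · rintro h1 ⟨x, hx⟩
      obtain ⟨k, hk⟩ := Code.evaln_complete.1 hx
      exact h1 k x hk
    · exact fun h1 n x hx => h1 ⟨x, Code.evaln_sound hx⟩
  choose b hb hb' using hspec
  have hcomp : Computable b := (hD.comp hs).of_eq fun c => hb c
  refine ComputablePred.halting_problem 0 (ComputablePred.computable_iff.2
    ⟨fun c => !(b c), Primrec.not.to_comp.comp hcomp, ?_⟩)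
  funext c
  simp [← Bool.not_eq_true, hb']

end Puiseux

/-! ### Puiseux series as a non-Archimedean ordered field -/

namespace Puiseux

/-- The series `ε ^ q`. -/
def monomial (q : ℚ) : Puiseux :=
  ⟨HahnSeries.single q 1, q.den, q.den_pos, fun x hx => ⟨q.num, by
    have : x = q := by simpa using HahnSeries.support_single_subset hx
    rw [this, Rat.num_div_den]⟩⟩

theorem monomial_mul (p q : ℚ) : monomial p * monomial q = monomial (p + q) := by
  apply Subtype.ext
  change HahnSeries.single p (1 : RealAlg) * HahnSeries.single q 1 = HahnSeries.single (p + q) 1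
  rw [HahnSeries.single_mul_single, one_mul]

theorem monomial_zero : monomial 0 = 1 := rfl

theorem monomial_pow (q : ℚ) (n : ℕ) : monomial q ^ n = monomial (n * q) := by
  induction n with
  | zero => simp [monomial_zero]
  | succ n ih => rw [pow_succ, ih, monomial_mul]; congr 1; push_cast; ring

theorem coeff_mul_monomial (x : Puiseux) (p q : ℚ) :
    (x * monomial p).1.coeff q = x.1.coeff (q - p) := by
  have := HahnSeries.coeff_mul_single_add (r := (1 : RealAlg)) (x := x.1) (a := q - p) (b := p)
  rwa [sub_add_cancel, mul_one] at this

/-- The substitution `t ↦ ε ^ (1 / d)`, from power series to Puiseux series. -/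
def ramified (d : ℕ) (hd : 0 < d) : PowerSeries RealAlg →+* Puiseux :=
  ((HahnSeries.embDomainRingHom (R := RealAlg)
    ((AddMonoidHom.mulRight (d : ℚ)⁻¹).comp (Nat.castAddMonoidHom ℚ))
    (fun m n h => by
      have : (d : ℚ) ≠ 0 := by positivity
      simpa [this] using h)
    (fun m n => by
      have : 0 < (d : ℚ)⁻¹ := by positivity
      simp [this])).comp
    (HahnSeries.toPowerSeries (R := RealAlg)).symm.toRingHom).codRestrict Puiseux.toSubring
    fun g => by
      refine ⟨d, hd, fun q hq => ?_⟩
      by_contra h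
      refine hq (HahnSeries.embDomain_of_notMem_range ?_)
      rintro ⟨n, rfl⟩
      exact h ⟨n, by simp [div_eq_mul_inv]⟩

theorem ramified_coeff {d : ℕ} (hd : 0 < d) (g : PowerSeries RealAlg) (n : ℕ) :
    (ramified d hd g).1.coeff (n / d) = PowerSeries.coeff n g := by
  rw [div_eq_mul_inv]
  exact HahnSeries.embDomain_coeff

theorem ramified_coeff_eq_zero {d : ℕ} (hd : 0 < d) (g : PowerSeries RealAlg) {q : ℚ}
    (h : ∀ n : ℕ, q ≠ n / d) : (ramified d hd g).1.coeff q = 0 := by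
  refine HahnSeries.embDomain_of_notMem_range ?_
  rintro ⟨n, rfl⟩
  exact h n (by simp [div_eq_mul_inv])

theorem ramified_coeff_zero {d : ℕ} (hd : 0 < d) (g : PowerSeries RealAlg) :
    (ramified d hd g).1.coeff 0 = PowerSeries.constantCoeff g := by
  have := ramified_coeff hd g 0
  simpa using this

theorem ramified_coeff_of_neg {d : ℕ} (hd : 0 < d) (g : PowerSeries RealAlg) {q : ℚ} (h : q < 0) :
    (ramified d hd g).1.coeff q = 0 := by
  refine ramified_coeff_eq_zero hd g fun n hn => absurd h (not_lt.2 ?_)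
  rw [hn]; positivity

theorem mem_range_ramified {d : ℕ} (hd : 0 < d) {x : Puiseux} :
    x ∈ (ramified d hd).range ↔ ∀ q, x.1.coeff q ≠ 0 → ∃ n : ℕ, q = n / d := by
  constructor
  · rintro ⟨g, rfl⟩ q hq
    by_contra! h
    exact hq (ramified_coeff_eq_zero hd g h)
  · intro h
    refine ⟨PowerSeries.mk fun n => x.1.coeff (n / d), Subtype.ext (HahnSeries.ext ?_)⟩
    funext q
    by_cases hq : ∃ n : ℕ, q = n / d
    · obtain ⟨n, rfl⟩ := hq
      rw [ramified_coeff, PowerSeries.coeff_mk]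
    · rw [ramified_coeff_eq_zero hd _ (not_exists.1 hq)]
      by_contra h2
      exact hq (h q (Ne.symm h2))

/-- Finitely many elements of `P₀` are power series in a common `ε ^ (1 / d)`. -/
theorem exists_mem_range_ramified {s : Set Puiseux} (hs : s.Finite)
    (h : ∀ x ∈ s, x ∈ nonnegPart) : ∃ (d : ℕ) (hd : 0 < d), ∀ x ∈ s, x ∈ (ramified d hd).range := by
  induction s, hs using Set.Finite.induction_on with
  | empty => exact ⟨1, one_pos, by simp⟩
  | @insert x s _ _ ih =>
    obtain ⟨d, hd, hds⟩ := ih fun y hy => h y (Set.mem_insert_of_mem _ hy)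
    obtain ⟨e, he, hx⟩ := x.2
    have hd' : (d : ℚ) ≠ 0 := by positivity
    have he' : (e : ℚ) ≠ 0 := by positivity
    refine ⟨d * e, Nat.mul_pos hd he, fun y hy => (mem_range_ramified _).2 fun q hq => ?_⟩
    rcases Set.mem_insert_iff.1 hy with rfl | hy
    · obtain ⟨k, hk⟩ := hx q hq
      have hq0 : 0 ≤ q := h y (Set.mem_insert _ _) q hq
      have hk0 : 0 ≤ k := by
        have he'' : (0 : ℚ) < e := by positivity
        rw [hk, le_div_iff₀ he'', zero_mul] at hq0
        exact_mod_cast hq0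
      obtain ⟨n, rfl⟩ := Int.eq_ofNat_of_zero_le hk0
      exact ⟨n * d, by rw [hk]; push_cast; field_simp⟩
    · obtain ⟨n, rfl⟩ := (mem_range_ramified hd).1 (hds y hy) q hq
      exact ⟨n * e, by push_cast; field_simp⟩

/-- A non-zero Puiseux series is a monomial times an invertible element of `P₀`. -/
theorem exists_mul_eq_one {x : Puiseux} (hx : x ≠ 0) : ∃ y, x * y = 1 := by
  have hx' : x.1 ≠ 0 := fun h => hx (Subtype.ext h)
  have hint : x * monomial (-x.1.order) ∈ nonnegPart := by
    intro q hq
    rw [HahnSeries.mem_support, coeff_mul_monomial, sub_neg_eq_add] at hq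
    have := HahnSeries.order_le_of_coeff_ne_zero hq
    linarith
  obtain ⟨d, hd, h⟩ := exists_mem_range_ramified (Set.finite_singleton _) (by simpa using hint)
  obtain ⟨g, hg⟩ := h _ rfl
  have hg0 : PowerSeries.constantCoeff g ≠ 0 := by
    rw [← ramified_coeff_zero hd, hg, coeff_mul_monomial, zero_sub, neg_neg]
    exact HahnSeries.coeff_order_eq_zero.not.2 hx'
  refine ⟨monomial (-x.1.order) * ramified d hd g⁻¹, ?_⟩
  rw [← mul_assoc, ← hg, ← map_mul, PowerSeries.mul_inv_cancel _ hg0, map_one]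

instance : Nontrivial Puiseux := ⟨0, 1, fun h => zero_ne_one (congrArg Subtype.val h)⟩

theorem isField : IsField Puiseux := ⟨⟨0, 1, zero_ne_one⟩, mul_comm, exists_mul_eq_one⟩

/-- The field structure of `Puiseux`, extending its ring structure as a subalgebra. -/
abbrev field : Field Puiseux := { isField.toField with toCommRing := Puiseux.toCommRing }

section Ordered

attribute [local instance] field

theorem isHeytingField : @IsHeytingField Puiseux Puiseux.toCommRing :=
  ⟨Field.instIsLocalRing Puiseux, fun _ hx => by_contra fun h => hx (isUnit_iff_ne_zero.2 h)⟩

/-- The order of `Puiseux` given by the sign of the leading coefficient. -/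
abbrev linearOrder : LinearOrder Puiseux :=
  LinearOrder.lift' (fun x => toLex x.1) fun _ _ h => Subtype.ext h

attribute [local instance] linearOrder

/-- The operations of the ordered field of Puiseux series. -/
def realClosedOps : RealClosedOps Puiseux :=
  @orderedFieldOps Puiseux field linearOrder (Subalgebra.algebra Puiseux)

theorem realClosedOps_le {x y : Puiseux} : realClosedOps.Le x y ↔ x ≤ y := orderedFieldOps_le

instance isStrictOrderedRing : IsStrictOrderedRing Puiseux :=
  Function.Injective.isStrictOrderedRing (fun x : Puiseux => toLex x.1)
    rfl rfl (fun _ _ => rfl) (fun _ _ => rfl) Iff.rfl Iff.rfl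

/-- Evaluating `kappa` at the order of `x` yields the sign of the leading coefficient; elsewhere
`kappa` is that sign or `0`. The zero series needs no separate case, its leading coefficient being
`0`. -/
theorem nonneg_iff {x : Puiseux} : Nonneg x ↔ 0 ≤ x := by
  have h : 0 ≤ x ↔ 0 ≤ x.1.leadingCoeff :=
    (HahnSeries.leadingCoeff_nonneg_iff (x := toLex x.1)).symm
  rw [h]
  constructor
  · intro h
    have := h x.1.order
    rw [kappa, if_pos le_rfl] at this
    exact sign_nonneg_iff.1 this
  · intro h q
    rw [kappa]
    split_ifs
    · exact sign_nonneg_iff.2 h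
    · exact le_rfl

theorem pos_of_coeff {x : Puiseux} {q : ℚ} (h : ∀ p < q, x.1.coeff p = 0)
    (hq : 0 < x.1.coeff q) : 0 < x :=
  (HahnSeries.lt_iff (toLex (0 : HahnSeries ℚ RealAlg)) (toLex x.1)).2
    ⟨q, fun p hp => (h p hp).symm, hq⟩

theorem ramified_pos {d : ℕ} (hd : 0 < d) {g : PowerSeries RealAlg}
    (h : 0 < PowerSeries.constantCoeff g) : 0 < ramified d hd g :=
  pos_of_coeff (fun _ hp => ramified_coeff_of_neg hd g hp) (by rwa [ramified_coeff_zero])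

/-- `P₀` is convex: if `x > 0` had negative order, then `x - y` would have the same leading term as
`x`, so `x > y`. -/
theorem mem_nonnegPart_of_nonneg_of_le {x y : Puiseux} (hx : 0 ≤ x) (hxy : x ≤ y)
    (hy : y ∈ nonnegPart) : x ∈ nonnegPart := by
  by_contra h
  have hx0 : x ≠ 0 := by rintro rfl; exact h (zero_mem _)
  have hpos : 0 < x := lt_of_le_of_ne hx hx0.symm
  have hlead : 0 < x.1.coeff x.1.order := by
    rw [← HahnSeries.leadingCoeff_eq]
    exact (HahnSeries.leadingCoeff_pos_iff (x := toLex x.1)).2 hpos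
  obtain ⟨q, hq, hq0⟩ : ∃ q, x.1.coeff q ≠ 0 ∧ q < 0 := by
    by_contra! h2
    exact h fun q hq => h2 q hq
  have hord : x.1.order < 0 := (HahnSeries.order_le_of_coeff_ne_zero hq).trans_lt hq0
  have hyc : ∀ p < 0, y.1.coeff p = 0 := fun p hp => by
    by_contra h2
    exact absurd (hy p h2) (not_le.2 hp)
  have : 0 < x - y := by
    refine pos_of_coeff (q := x.1.order) (fun p hp => ?_) ?_
    · change x.1.coeff p - y.1.coeff p = 0
      rw [HahnSeries.coeff_eq_zero_of_lt_order hp, hyc p (hp.trans hord), sub_zero]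
    · change 0 < x.1.coeff x.1.order - y.1.coeff x.1.order
      rwa [hyc _ hord, sub_zero]
  exact absurd hxy (not_le.2 (sub_pos.1 this))

theorem abs_mem_nonnegPart {x : Puiseux} : |x| ∈ nonnegPart ↔ x ∈ nonnegPart := by
  rcases abs_choice x with h | h <;> rw [h]
  exact neg_mem_iff

/-- No natural number is an upper bound of `ε⁻¹`. -/
theorem not_isArchimedean : ¬ realClosedOps.IsArchimedean := by
  intro h
  obtain ⟨n, hn⟩ := h (monomial (-1))
  replace hn : |monomial (-1)| ≤ (n : Puiseux) := realClosedOps_le.1 hn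
  have h1 := abs_mem_nonnegPart.1 (mem_nonnegPart_of_nonneg_of_le (abs_nonneg _) hn
    (natCast_mem nonnegPart n))
  have h2 := h1 (-1) (by
    change (HahnSeries.single (-1 : ℚ) (1 : RealAlg)).coeff (-1) ≠ 0
    simp)
  linarith

end Ordered

end Puiseux

/-- A translation kills the subleading coefficient of a monic polynomial. -/
theorem Polynomial.Monic.exists_taylor_coeff_eq_zero {F : Type*} [Field F] [CharZero F] {f : F[X]}
    {n : ℕ} (hf : f.Monic) (hn : f.natDegree = n + 1) : ∃ r, (taylor r f).coeff n = 0 := by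
  have hlead : f.coeff (n + 1) = 1 := hn ▸ hf
  have h : ∀ r, (taylor r f).coeff n = f.coeff n + (n + 1) * r := fun r => by
    have hd : (hasseDeriv n f).natDegree < 2 := by
      have := natDegree_hasseDeriv_le f n
      omega
    rw [taylor_coeff, eval_eq_sum_range' hd, Finset.sum_range_succ, Finset.sum_range_one,
      hasseDeriv_coeff, hasseDeriv_coeff, zero_add, add_comm 1 n, hlead]
    simp
  have hn0 : (n + 1 : F) ≠ 0 := Nat.cast_add_one_ne_zero n
  exact ⟨-f.coeff n / (n + 1), by rw [h]; field_simp; ring⟩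

/-! ### Stability of the intermediate value property -/

section IntermediateValue

variable {F : Type*} [Field F] [LinearOrder F]

/-- The intermediate value property of the polynomial `f`. -/
def Polynomial.HasIVP (f : F[X]) : Prop :=
  ∀ a b, a < b → f.eval a * f.eval b < 0 → ∃ c, a < c ∧ c < b ∧ f.eval c = 0

variable [IsStrictOrderedRing F] {f g : F[X]}

/-- A product changes sign only if one of its factors does. -/
theorem Polynomial.HasIVP.mul (hf : f.HasIVP) (hg : g.HasIVP) : (f * g).HasIVP := by
  intro a b hab h
  simp only [eval_mul] at h ⊢
  rw [mul_mul_mul_comm] at h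
  rcases mul_neg_iff.1 h with ⟨-, h⟩ | ⟨h, -⟩
  · obtain ⟨c, h1, h2, h3⟩ := hg a b hab h
    exact ⟨c, h1, h2, by rw [h3, mul_zero]⟩
  · obtain ⟨c, h1, h2, h3⟩ := hf a b hab h
    exact ⟨c, h1, h2, by rw [h3, zero_mul]⟩

theorem Polynomial.HasIVP.of_taylor (r : F) (h : (taylor r f).HasIVP) : f.HasIVP := by
  intro a b hab hs
  obtain ⟨c, h1, h2, h3⟩ := h (a - r) (b - r) (sub_lt_sub_right hab r)
    (by rwa [taylor_eval, taylor_eval, sub_add_cancel, sub_add_cancel])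
  exact ⟨c + r, lt_add_of_sub_right_lt h1, add_lt_of_lt_sub_right h2, by rwa [taylor_eval] at h3⟩

theorem Polynomial.HasIVP.of_scaleRoots {s : F} (hs : 0 < s) (h : (f.scaleRoots s).HasIVP) :
    f.HasIVP := by
  intro a b hab hab'
  have hpos : 0 < s ^ f.natDegree := pow_pos hs _
  obtain ⟨c, h1, h2, h3⟩ := h (s * a) (s * b) (mul_lt_mul_of_pos_left hab hs) (by
    rw [scaleRoots_eval_mul, scaleRoots_eval_mul, mul_mul_mul_comm]
    exact mul_neg_of_pos_of_neg (mul_pos hpos hpos) hab')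
  have hc : s * (s⁻¹ * c) = c := mul_inv_cancel_left₀ hs.ne' c
  rw [← hc] at h1 h2 h3
  rw [scaleRoots_eval_mul, mul_eq_zero] at h3
  exact ⟨s⁻¹ * c, lt_of_mul_lt_mul_left h1 hs.le, lt_of_mul_lt_mul_left h2 hs.le,
    h3.resolve_left hpos.ne'⟩

theorem Polynomial.hasIVP_of_eval_pos (h : ∀ x, 0 < f.eval x) : f.HasIVP :=
  fun a b _ hs => absurd hs (not_lt.2 (mul_pos (h a) (h b)).le)

theorem Polynomial.hasIVP_X : (X : F[X]).HasIVP := by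
  intro a b hab h
  simp only [eval_X] at h ⊢
  rcases mul_neg_iff.1 h with ⟨h1, h2⟩ | ⟨h1, h2⟩
  · exact absurd hab (not_lt.2 (h2.trans h1).le)
  · exact ⟨0, h1, h2, rfl⟩

theorem Polynomial.hasIVP_X_pow (n : ℕ) : (X ^ n : F[X]).HasIVP := by
  induction n with
  | zero => exact hasIVP_of_eval_pos fun x => by simp
  | succ n ih => rw [pow_succ]; exact ih.mul hasIVP_X

end IntermediateValue

/-! ### The intermediate value property for Puiseux series -/

namespace Puiseux

attribute [local instance] field linearOrder

/-- After scaling the roots by a power of `ε`, a monic polynomial has its coefficients in `P₀`,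
and a coefficient besides the leading one does not vanish at `ε = 0`. -/
theorem exists_scaleRoots_monomial {f : Puiseux[X]} (hne : ∃ i < f.natDegree, f.coeff i ≠ 0) :
    ∃ q : ℚ, (∀ i < f.natDegree, (f.scaleRoots (monomial q)).coeff i ∈ nonnegPart) ∧
      ∃ i < f.natDegree, ((f.scaleRoots (monomial q)).coeff i).1.coeff 0 ≠ 0 := by
  classical
  set n := f.natDegree
  let s := (Finset.range n).filter fun i => f.coeff i ≠ 0
  have hs : s.Nonempty := by
    obtain ⟨i, hi, hi'⟩ := hne
    exact ⟨i, by simp [s, hi, hi']⟩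
  -- A slope of the Newton polygon. Scaling by `ε ^ q` adds `(n - i) q` to the order of the `i`-th
  -- coefficient; taking `q` opposite to the least quotient makes these orders nonnegative, with
  -- value `0` at `i₀`.
  obtain ⟨i₀, hi₀, hmin⟩ := s.exists_min_image (fun i => (f.coeff i).1.order / ((n : ℚ) - i)) hs
  simp only [s, Finset.mem_filter, Finset.mem_range] at hi₀ hmin
  have hcoeff : ∀ q i p, ((f.scaleRoots (monomial q)).coeff i).1.coeff p =
      (f.coeff i).1.coeff (p - (n - i : ℕ) * q) := fun q i p => by
    rw [coeff_scaleRoots, monomial_pow, coeff_mul_monomial]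
  refine ⟨-((f.coeff i₀).1.order / ((n : ℚ) - i₀)), fun i hi p hp => ?_, i₀, hi₀.1, ?_⟩
  · rw [HahnSeries.mem_support, hcoeff, Nat.cast_sub hi.le] at hp
    have hi' : f.coeff i ≠ 0 := fun h => by rw [h] at hp; exact hp rfl
    have h1 := HahnSeries.order_le_of_coeff_ne_zero hp
    have h2 := hmin i ⟨hi, hi'⟩
    have h3 : (0 : ℚ) < n - i := sub_pos.2 (by exact_mod_cast hi)
    rw [le_div_iff₀ h3] at h2
    linarith
  · have h3 : (n : ℚ) - i₀ ≠ 0 := (sub_pos.2 (by exact_mod_cast hi₀.1)).ne'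
    rw [hcoeff, Nat.cast_sub hi₀.1.le, zero_sub, mul_neg, neg_neg, mul_div_cancel₀ _ h3]
    exact HahnSeries.coeff_order_eq_zero.not.2 fun h => hi₀.2 (Subtype.ext h)

/-- Finitely many coefficients have a common ramification index, so the problem descends to the
power series ring, where Weierstrass preparation is available. -/
theorem exists_map_ramified_eq {f : Puiseux[X]} (hf : f.Monic)
    (hint : ∀ i, f.coeff i ∈ nonnegPart) {x : Puiseux} (hx : x ∈ nonnegPart) :
    ∃ (d : ℕ) (hd : 0 < d) (g : (PowerSeries RealAlg)[X]), g.Monic ∧ g.map (ramified d hd) = f ∧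
      x ∈ (ramified d hd).range := by
  have hfin : (f.coeff '' Set.Iic f.natDegree).Finite := (Set.finite_Iic _).image _
  obtain ⟨d, hd, hrange⟩ := exists_mem_range_ramified (hfin.insert x) (by
    rintro y (rfl | ⟨i, -, rfl⟩)
    · exact hx
    · exact hint i)
  obtain ⟨g, hg, -, hgm⟩ := lifts_and_natDegree_eq_and_monic
    ((lifts_iff_coeff_lifts (f := ramified d hd) f).2 fun i => by
      rcases le_or_gt i f.natDegree with hi | hi
      · exact hrange _ (Set.mem_insert_of_mem _ ⟨i, hi, rfl⟩)
      · exact ⟨0, by rw [coeff_eq_zero_of_natDegree_lt hi, map_zero]⟩) hf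
  exact ⟨d, hd, g, hgm, hg, hrange x (Set.mem_insert _ _)⟩

/-- A monic polynomial over `P₀` whose reduction at `ε = 0` has no root is positive. -/
theorem eval_pos_of_reduction_no_root {f : Puiseux[X]} (hf : f.Monic)
    (hint : ∀ i, f.coeff i ∈ nonnegPart) {h : RealAlg[X]}
    (hh : ∀ i, h.coeff i = (f.coeff i).1.coeff 0) (hroot : ∀ c, ¬ h.IsRoot c) (x : Puiseux) :
    0 < f.eval x := by
  have hpos : ∀ x ∈ nonnegPart, 0 < f.eval x := by
    intro x hx
    obtain ⟨d, hd, g, hgm, hg, y, rfl⟩ := exists_map_ramified_eq hf hint hx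
    have e : g.map PowerSeries.constantCoeff = h := by
      ext i
      rw [hh, ← hg, coeff_map, coeff_map, ramified_coeff_zero]
    rw [← hg, eval_map, eval₂_at_apply]
    refine ramified_pos hd ?_
    rw [← eval₂_at_apply, ← eval_map, e]
    exact RealAlg.polynomialIVT.eval_pos (e ▸ hgm.map _) hroot _
  set N : Puiseux := 1 + ∑ i ∈ Finset.range f.natDegree, |f.coeff i| with hN
  have hNint : N ∈ nonnegPart :=
    add_mem (one_mem _) (sum_mem fun i _ => abs_mem_nonnegPart.2 (hint i))
  rcases le_or_gt |x| N with hx | hx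
  · exact hpos x (abs_mem_nonnegPart.1 (mem_nonnegPart_of_nonneg_of_le (abs_nonneg _) hx hNint))
  rcases lt_abs.1 hx with hx | hx
  · exact hf.eval_pos hx.le
  -- The point `-N` lies in `P₀`, so `f(-N) > 0` is known; this forces `(-1) ^ deg f > 0`, hence
  -- `f(x) > 0` further left.
  · have h1 := hf.neg_one_pow_mul_eval_pos (x := -N) (by rw [hN])
    have h2 := hf.neg_one_pow_mul_eval_pos (x := x) (by rw [← hN]; linarith)
    have h3 := hpos (-N) (neg_mem hNint)
    exact pos_of_mul_pos_right h2 (pos_of_mul_pos_left h1 h3.le).le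

theorem monomial_pos (q : ℚ) : 0 < monomial q :=
  pos_of_coeff (q := q) (fun p hp => HahnSeries.coeff_single_of_ne hp.ne)
    (by change 0 < (HahnSeries.single q (1 : RealAlg)).coeff q; simp)

/-- A monic polynomial over `P₀` without subleading term, whose reduction at `ε = 0` is not
a power of `X`, has the intermediate value property as soon as polynomials of smaller degree do. -/
theorem hasIVP_of_reduction {n : ℕ}
    (ih : ∀ f : Puiseux[X], f.Monic → f.natDegree < n + 1 → f.HasIVP)
    {f : Puiseux[X]} (hf : f.Monic) (hn : f.natDegree = n + 1)
    (hint : ∀ i, f.coeff i ∈ nonnegPart) (hcn : f.coeff n = 0)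
    {i : ℕ} (hi : i < n + 1) (hne : (f.coeff i).1.coeff 0 ≠ 0) : f.HasIVP := by
  obtain ⟨d, hd, g, hgm, hg, -⟩ := exists_map_ramified_eq hf hint (zero_mem _)
  have hgn : g.natDegree = n + 1 := by rw [← hn, ← hg, hgm.natDegree_map]
  have hgc : ∀ i, (g.map PowerSeries.constantCoeff).coeff i = (f.coeff i).1.coeff 0 := fun i => by
    rw [coeff_map, ← hg, coeff_map, ramified_coeff_zero]
  by_cases hroot : ∃ c, (g.map PowerSeries.constantCoeff).IsRoot c
  swap
  · push Not at hroot
    exact hasIVP_of_eval_pos (eval_pos_of_reduction_no_root hf hint hgc hroot)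
  obtain ⟨c, hc⟩ := hroot
  obtain ⟨u, v, hu, hv, huv, h1, h2⟩ := hgm.exists_factorization_of_isRoot hc (by
    rw [hgn]
    -- If the reduction were `(X - c) ^ (n + 1)`, its vanishing subleading coefficient `-(n + 1) c`
    -- would give `c = 0`, and `X ^ (n + 1)` contradicts `hne`.
    intro e
    have e1 := hgc n
    have e2 := hgc i
    have h0 : (f.coeff n).1.coeff 0 = 0 := by rw [hcn]; rfl
    rw [h0, e, sub_eq_add_neg, ← C_neg, coeff_X_add_C_pow] at e1
    have hc0 : c = 0 := by
      have : (n + 1 : RealAlg) ≠ 0 := Nat.cast_add_one_ne_zero n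
      simpa [this] using e1
    rw [e, hc0, C_0, sub_zero, coeff_X_pow, if_neg hi.ne] at e2
    exact hne e2.symm)
  have hdeg : g.natDegree = u.natDegree + v.natDegree := by rw [huv, hu.natDegree_mul hv]
  rw [← hg, huv, Polynomial.map_mul]
  refine (ih _ (hu.map _) ?_).mul (ih _ (hv.map _) ?_)
  · rw [hu.natDegree_map]; omega
  · rw [hv.natDegree_map]; omega

/-- Strong induction on the degree: translate to remove the subleading term, treat `X ^ n` directly,
and otherwise scale the roots to reach the hypotheses of `hasIVP_of_reduction`. Both changes of
variable preserve the order. -/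
theorem hasIVP_of_monic : ∀ f : Puiseux[X], f.Monic → f.HasIVP := by
  suffices h : ∀ n, ∀ f : Puiseux[X], f.Monic → f.natDegree < n → f.HasIVP from
    fun f hf => h _ f hf (Nat.lt_succ_self _)
  intro n
  induction n with
  | zero => exact fun f _ h => absurd h (Nat.not_lt_zero _)
  | succ n ih =>
  intro f hf hn
  rcases n with _ | n
  · rw [hf.natDegree_eq_zero.1 (by omega), ← pow_zero X]
    exact hasIVP_X_pow 0
  rcases (Nat.lt_succ_iff.1 hn).lt_or_eq with hn | hn
  · exact ih f hf hn
  obtain ⟨r, hr⟩ := hf.exists_taylor_coeff_eq_zero hn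
  refine HasIVP.of_taylor r ?_
  have hn₁ : (taylor r f).natDegree = n + 1 := by rw [natDegree_taylor, hn]
  have hm₁ : (taylor r f).Monic := by rw [Monic, leadingCoeff_taylor]; exact hf
  generalize taylor r f = f₁ at hr hn₁ hm₁ ⊢
  by_cases hne : ∃ i < f₁.natDegree, f₁.coeff i ≠ 0
  swap
  · have e : f₁ = X ^ (n + 1) := by
      push Not at hne
      have := hm₁.as_sum
      rwa [Finset.sum_eq_zero (fun i hi => by
        rw [hne i (Finset.mem_range.1 hi), C_0, zero_mul]), add_zero, hn₁] at this
    rw [e]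
    exact hasIVP_X_pow _
  obtain ⟨q, hint, i, hi, hunit⟩ := exists_scaleRoots_monomial hne
  refine HasIVP.of_scaleRoots (monomial_pos q) ?_
  have hn₂ : (f₁.scaleRoots (monomial q)).natDegree = n + 1 := by rw [natDegree_scaleRoots, hn₁]
  have hm₂ : (f₁.scaleRoots (monomial q)).Monic := (monic_scaleRoots_iff _).2 hm₁
  refine hasIVP_of_reduction ih hm₂ hn₂ (fun i => ?_)
    (by rw [coeff_scaleRoots, hr, zero_mul]) (hn₁ ▸ hi) hunit
  rcases lt_trichotomy i (n + 1) with hi | rfl | hi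
  · exact hint i (by omega)
  · rw [← hn₂, hm₂.coeff_natDegree]; exact one_mem _
  · rw [coeff_eq_zero_of_natDegree_lt (by omega)]; exact zero_mem _

theorem polynomialIVT : PolynomialIVT Puiseux := by
  intro f a b hab h
  have hf : f ≠ 0 := by rintro rfl; simp at h
  have hl : f.leadingCoeff ≠ 0 := leadingCoeff_ne_zero.2 hf
  have hi : 0 < f.leadingCoeff⁻¹ * f.leadingCoeff⁻¹ := mul_self_pos.2 (inv_ne_zero hl)
  obtain ⟨c, h1, h2, h3⟩ := hasIVP_of_monic _ (monic_mul_leadingCoeff_inv hf) a b hab (by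
      simp only [eval_mul, eval_C]
      rw [mul_mul_mul_comm]
      exact mul_neg_of_neg_of_pos h hi)
  rw [eval_mul, eval_C, mul_eq_zero] at h3
  exact ⟨c, h1, h2, h3.resolve_right (inv_ne_zero hl)⟩

theorem isNondiscreteRealClosedField :
    @RealClosedOps.IsNondiscreteRealClosedField Puiseux _ realClosedOps
      (Subalgebra.algebra Puiseux) :=
  @orderedFieldOps_isNondiscreteRealClosedField Puiseux field linearOrder isStrictOrderedRing
    (Subalgebra.algebra Puiseux) polynomialIVT

end Puiseux

end

theorem mainTheorem7 :
    ∃ S : RealClosedOps Puiseux,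
      (∀ α : Puiseux, S.Le 0 α ↔ Puiseux.Nonneg α) ∧
      S.IsNondiscreteRealClosedField ∧
      IsHeytingField Puiseux ∧
      ¬ S.IsArchimedean ∧
      ¬ Puiseux.HasZeroTest :=
  ⟨Puiseux.realClosedOps, fun _ => Puiseux.realClosedOps_le.trans Puiseux.nonneg_iff.symm,
    Puiseux.isNondiscreteRealClosedField, Puiseux.isHeytingField, Puiseux.not_isArchimedean,
    Puiseux.not_hasZeroTest⟩
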